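/- Let $m \in \mathbb{N}$ (with $m=0$ allowed), let $\mathbb{T}$ be the circle group, let $F$ be a finite abelian group with the discrete topology, and let $r\colon F\times\mathbb{T}^m\to H$ be a continuous surjective group homomorphism onto a compact Hausdorff topological group $H$. Then there are a finite abelian group $F'$ (with the discrete topology) of order $|F'|\le |F|$ and an integer $n$ with $0 \le n\le m$ such that $H\cong F'\times\mathbb{T}^n$ as topological groups. Moreover, whenever $H\cong F'\times\mathbb{T}^n$ as topological groups with $F'$ a finite discrete abelian group and $n \ge 0$ an integer, one has $n=m$ if and only if the kernel of $r$ is finite. -/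

import Mathlib

/-!
Restrict `r` to the torus and pull its kernel back along the universal covering `ℝ^m → 𝕋^m`: the
result is a closed subgroup `L` spanning `ℝ^m`. Modulo the largest real subspace contained in `L`,
the group `L` becomes a lattice, so `r(𝕋^m) ≅ ℝ^m / L` is again a torus `𝕋^n`, and `n = m` forces
`L` to be discrete and the kernel to be finite. Being divisible, the torus `r(𝕋^m)` is a direct
factor of `H`; it is open, so the splitting is topological, and its complement is isomorphic to
`H / r(𝕋^m)`, which is a quotient of `F`.

Conversely, for a large prime `p` the group `F' × 𝕋^n` has exactly `p^n` elements of exponent `p`,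
and a surjection with finite kernel preserves this number. Hence `n` is determined by `H`, and it
equals `m` as soon as `r` has finite kernel.
-/

open Filter Topology

section ClosedSubgroup

theorem tendsto_floor_div_mul {α : Type*} {l : Filter α} {a : α → ℝ} (ha : Tendsto a l (𝓝 0))
    (ha₀ : ∀ k, a k ≠ 0) (t : ℝ) : Tendsto (fun k => ⌊t / a k⌋ * a k) l (𝓝 t) := by
  have hfract : Tendsto (fun k => t - Int.fract (t / a k) * a k) l (𝓝 (t - 0)) :=
    tendsto_const_nhds.sub (bdd_le_mul_tendsto_zero' 1
      (.of_forall fun k => Int.abs_fract.trans_le (Int.fract_lt_one (t / a k)).le) ha)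
  rw [sub_zero] at hfract
  refine hfract.congr fun k => ?_
  rw [← Int.self_sub_floor, sub_mul, div_mul_cancel₀ t (ha₀ k), sub_sub_cancel]

variable {E : Type*} [NormedAddCommGroup E] [NormedSpace ℝ E] {L : AddSubgroup E}

theorem smul_mem_of_tendsto_inv_norm_smul (hL : IsClosed (L : Set E)) {x : ℕ → E} {u : E}
    (hxL : ∀ k, x k ∈ L) (hx₀ : ∀ k, x k ≠ 0) (hx : Tendsto x atTop (𝓝 0))
    (hu : Tendsto (fun k => ‖x k‖⁻¹ • x k) atTop (𝓝 u)) (t : ℝ) : t • u ∈ L := by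
  have hnorm₀ : ∀ k, ‖x k‖ ≠ 0 := fun k => norm_ne_zero_iff.2 (hx₀ k)
  -- `t • u` is the limit of the integer multiples `⌊t / ‖x k‖⌋ • x k`
  have hlim := (tendsto_floor_div_mul (tendsto_zero_iff_norm_tendsto_zero.1 hx) hnorm₀ t).smul hu
  refine hL.mem_of_tendsto hlim (.of_forall fun k => ?_)
  rw [smul_smul, mul_assoc, mul_inv_cancel₀ (hnorm₀ k), mul_one, Int.cast_smul_eq_zsmul]
  exact L.zsmul_mem (hxL k) _

theorem zero_mem_closure_diff_of_not_discreteTopology {A : Type*} [AddGroup A]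
    [TopologicalSpace A] [IsTopologicalAddGroup A] {L : AddSubgroup A}
    (hL : ¬ DiscreteTopology L) : (0 : A) ∈ closure ((L : Set A) \ {0}) := by
  contrapose! hL
  refine discreteTopology_of_isOpen_singleton_zero ?_
  suffices {0} = ((↑) : L → A) ⁻¹' (closure ((L : Set A) \ {0}))ᶜ from
    this ▸ isClosed_closure.isOpen_compl.preimage continuous_subtype_val
  ext x
  refine ⟨fun hx => ?_, fun hx => ?_⟩
  · rwa [Set.mem_singleton_iff.1 hx]
  · by_contra hx₀
    exact hx (subset_closure ⟨x.2, fun h => hx₀ (Subtype.ext h)⟩)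

theorem exists_ne_zero_forall_smul_mem_of_not_discreteTopology [FiniteDimensional ℝ E]
    (hL : IsClosed (L : Set E)) (hdisc : ¬ DiscreteTopology L) :
    ∃ u ≠ 0, ∀ t : ℝ, t • u ∈ L := by
  obtain ⟨x, hxL, hx⟩ :=
    mem_closure_iff_seq_limit.1 (zero_mem_closure_diff_of_not_discreteTopology hdisc)
  have : ProperSpace E := FiniteDimensional.proper ℝ E
  have hsphere : ∀ k, ‖x k‖⁻¹ • x k ∈ Metric.sphere (0 : E) 1 := fun k => by
    simp [norm_smul, show x k ≠ 0 from (hxL k).2]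
  obtain ⟨u, hu, φ, hφ, hlim⟩ := (isCompact_sphere (0 : E) 1).tendsto_subseq hsphere
  exact ⟨u, ne_zero_of_mem_unit_sphere ⟨u, hu⟩,
    smul_mem_of_tendsto_inv_norm_smul hL (fun k => (hxL (φ k)).1) (fun k => (hxL (φ k)).2)
      (hx.comp hφ.tendsto_atTop) hlim⟩

/-- The largest real subspace contained in an additive subgroup `L`: the union of the lines
through the origin lying in `L`. -/
def largestSubmodule {E : Type*} [AddCommGroup E] [Module ℝ E] (L : AddSubgroup E) :
    Submodule ℝ E where
  carrier := {x | ∀ t : ℝ, t • x ∈ L}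
  add_mem' hx hy t := by
    rw [smul_add]
    exact L.add_mem (hx t) (hy t)
  zero_mem' t := by
    rw [smul_zero]
    exact L.zero_mem
  smul_mem' c x hx t := by
    rw [smul_smul]
    exact hx (t * c)

theorem mkQ_mem_map_iff {E : Type*} [AddCommGroup E] [Module ℝ E] {L : AddSubgroup E} {x : E} :
    (largestSubmodule L).mkQ x ∈ L.map (largestSubmodule L).mkQ.toAddMonoidHom ↔ x ∈ L := by
  have hker : (largestSubmodule L).mkQ.toAddMonoidHom.ker ≤ L := fun y hy => by
    have hy' : y ∈ largestSubmodule L := (Submodule.Quotient.mk_eq_zero _).1 hy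
    simpa using hy' 1
  exact SetLike.ext_iff.1 (AddSubgroup.comap_map_eq_self hker) x

theorem isClosed_map_mkQ (hL : IsClosed (L : Set E)) :
    IsClosed (L.map (largestSubmodule L).mkQ.toAddMonoidHom : Set (E ⧸ largestSubmodule L)) := by
  rw [← (largestSubmodule L).isOpenQuotientMap_mkQ.isQuotientMap.isClosed_preimage]
  convert! hL
  ext x
  exact mkQ_mem_map_iff

theorem discreteTopology_map_mkQ [FiniteDimensional ℝ E] (hL : IsClosed (L : Set E)) :
    DiscreteTopology (L.map (largestSubmodule L).mkQ.toAddMonoidHom) := by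
  have : IsClosed (largestSubmodule L : Set E) := (largestSubmodule L).closed_of_finiteDimensional
  by_contra hdisc
  obtain ⟨u, hu₀, hu⟩ :=
    exists_ne_zero_forall_smul_mem_of_not_discreteTopology (isClosed_map_mkQ hL) hdisc
  obtain ⟨x, rfl⟩ := Submodule.mkQ_surjective _ u
  refine hu₀ ((Submodule.Quotient.mk_eq_zero _).2 fun t => mkQ_mem_map_iff.1 ?_)
  rw [map_smul]
  exact hu t

theorem exists_linearEquiv_mem_iff_of_discreteTopology [FiniteDimensional ℝ E]
    [DiscreteTopology L] (hspan : Submodule.span ℝ (L : Set E) = ⊤) :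
    ∃ φ : E ≃ₗ[ℝ] (Fin (Module.finrank ℝ E) → ℝ),
      ∀ x, x ∈ L ↔ φ x ∈ Submodule.span ℤ (Set.range (Pi.basisFun ℝ _)) := by
  let Λ : Submodule ℤ E := L.toIntSubmodule
  have : DiscreteTopology Λ := ‹DiscreteTopology L›
  have : IsZLattice ℝ Λ := ⟨hspan⟩
  have := ZLattice.module_free ℝ Λ
  let b := (Module.Free.chooseBasis ℤ Λ).ofZLatticeBasis ℝ Λ
  let B := b.reindex (b.indexEquiv (Module.finBasis ℝ E))
  have hB : Submodule.span ℤ (Set.range B) = Λ := by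
    rw [b.range_reindex, Module.Basis.ofZLatticeBasis_span]
  refine ⟨B.equivFun, fun x => ?_⟩
  rw [(Pi.basisFun ℝ _).mem_span_iff_repr_mem ℤ]
  change x ∈ Λ ↔ _
  rw [← hB, B.mem_span_iff_repr_mem ℤ]
  rfl

theorem exists_surjective_linearMap_mem_iff_of_isClosed [FiniteDimensional ℝ E]
    (hL : IsClosed (L : Set E)) (hspan : Submodule.span ℝ (L : Set E) = ⊤) :
    ∃ (n : ℕ) (φ : E →ₗ[ℝ] (Fin n → ℝ)), Function.Surjective φ ∧
      ∀ x, x ∈ L ↔ φ x ∈ Submodule.span ℤ (Set.range (Pi.basisFun ℝ (Fin n))) := by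
  let π := (largestSubmodule L).mkQ
  have : IsClosed (largestSubmodule L : Set E) := (largestSubmodule L).closed_of_finiteDimensional
  have := discreteTopology_map_mkQ hL
  have hspan_map : Submodule.span ℝ (π '' (L : Set E)) = ⊤ := by
    rw [Submodule.span_image, hspan, Submodule.map_top, Submodule.range_mkQ]
  obtain ⟨φ, hφ⟩ :=
    exists_linearEquiv_mem_iff_of_discreteTopology (L := L.map π.toAddMonoidHom) hspan_map
  exact ⟨_, φ.toLinearMap ∘ₗ π, φ.surjective.comp (Submodule.mkQ_surjective _),
    fun x => mkQ_mem_map_iff.symm.trans (hφ (π x))⟩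

end ClosedSubgroup

section Torus

/-- The universal covering homomorphism `x ↦ (exp (2πi xⱼ))ⱼ` of the torus `𝕋^ι`, normalized so
that its kernel is the standard integer lattice. -/
noncomputable def torusExp (ι : Type*) : Multiplicative (ι → ℝ) →* (ι → Circle) where
  toFun x j := Real.fourierChar (x.toAdd j)
  map_one' := funext fun _ => Real.fourierChar.map_zero_eq_one
  map_mul' _ _ := funext fun _ => Real.fourierChar.map_add_eq_mul _ _

theorem isOpenQuotientMap_fourierChar : IsOpenQuotientMap Real.fourierChar := by
  have hexp : IsOpenQuotientMap Circle.exp :=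
    ⟨Circle.exp_surjective, Circle.exp.continuous, isLocalHomeomorph_circleExp.isOpenMap⟩
  exact hexp.comp (Homeomorph.mulLeft₀ (2 * Real.pi) Real.two_pi_pos.ne').isOpenQuotientMap

theorem isOpenQuotientMap_torusExp (ι : Type*) : IsOpenQuotientMap (torusExp ι) :=
  IsOpenQuotientMap.piMap fun _ => isOpenQuotientMap_fourierChar

theorem fourierChar_eq_one_iff {x : ℝ} : Real.fourierChar x = 1 ↔ ∃ k : ℤ, (k : ℝ) = x := by
  refine Circle.exp_eq_one.trans (exists_congr fun k => ?_)
  rw [mul_comm, mul_left_inj' Real.two_pi_pos.ne', eq_comm]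

theorem torusExp_eq_one_iff {ι : Type*} [Finite ι] {x : Multiplicative (ι → ℝ)} :
    torusExp ι x = 1 ↔ x.toAdd ∈ Submodule.span ℤ (Set.range (Pi.basisFun ℝ ι)) := by
  rw [(Pi.basisFun ℝ ι).mem_span_iff_repr_mem ℤ]
  exact funext_iff.trans (forall_congr' fun _ => fourierChar_eq_one_iff)

theorem exists_continuous_injective_hom_of_ker_eq {E A H : Type*} [Group E] [TopologicalSpace E]
    [Group A] [TopologicalSpace A] [Group H] [TopologicalSpace H] {p : E →* A}
    (hp : IsOpenQuotientMap p) {g : E →* H} (hg : Continuous g) (hker : p.ker = g.ker) :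
    ∃ σ : A →* H, Continuous σ ∧ Function.Injective σ ∧ σ.comp p = g := by
  let σ : A →* H := p.liftOfSurjective hp.surjective ⟨g, hker.le⟩
  have hσ : σ.comp p = g := p.liftOfRightInverse_comp _ _ _
  refine ⟨σ, hp.continuous_comp_iff.1 ?_, (injective_iff_map_eq_one σ).2 fun a ha => ?_, hσ⟩
  · rwa [← MonoidHom.coe_comp, hσ]
  · obtain ⟨x, rfl⟩ := hp.surjective a
    rwa [← MonoidHom.comp_apply, hσ, ← MonoidHom.mem_ker, ← hker] at ha

variable {ι H : Type*} [Group H] {ρ : (ι → Circle) →* H}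

/-- The kernel of a torus homomorphism lifted to the universal cover, written additively. -/
noncomputable def liftedKer (ρ : (ι → Circle) →* H) : AddSubgroup (ι → ℝ) :=
  (ρ.comp (torusExp ι)).ker.toAddSubgroup'

theorem mem_liftedKer {x : ι → ℝ} :
    x ∈ liftedKer ρ ↔ ρ (torusExp ι (.ofAdd x)) = 1 :=
  Iff.rfl

theorem isClosed_liftedKer [TopologicalSpace H] [T1Space H] (hρ : Continuous ρ) :
    IsClosed (liftedKer ρ : Set (ι → ℝ)) :=
  isClosed_singleton.preimage
    (hρ.comp ((isOpenQuotientMap_torusExp ι).continuous.comp continuous_ofAdd))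

theorem span_liftedKer [Finite ι] (ρ : (ι → Circle) →* H) :
    Submodule.span ℝ (liftedKer ρ : Set (ι → ℝ)) = ⊤ := by
  rw [eq_top_iff, ← (Pi.basisFun ℝ ι).span_eq]
  refine Submodule.span_mono fun x hx => ?_
  have hx_exp : torusExp ι (.ofAdd x) = 1 := torusExp_eq_one_iff.2 (Submodule.subset_span hx)
  exact mem_liftedKer.2 (by rw [hx_exp, map_one])

theorem finite_ker_of_discreteTopology_liftedKer [TopologicalSpace H] [T1Space H]
    (hρ : Continuous ρ) [DiscreteTopology (liftedKer ρ)] : Finite ρ.ker := by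
  have : CompactSpace ρ.ker := isCompact_iff_compactSpace.1
    (isClosed_singleton.preimage hρ).isCompact
  have : DiscreteTopology ρ.ker := by
    obtain ⟨U, hU, hU_inter⟩ := isOpen_induced_iff.1 (isOpen_discrete ({0} : Set (liftedKer ρ)))
    have hopen : IsOpen (torusExp ι '' (Multiplicative.toAdd ⁻¹' U)) :=
      (isOpenQuotientMap_torusExp ι).isOpenMap _ (hU.preimage continuous_toAdd)
    refine discreteTopology_of_isOpen_singleton_one ?_
    suffices {1} = ((↑) : ρ.ker → ι → Circle) ⁻¹' (torusExp ι '' (Multiplicative.toAdd ⁻¹' U)) from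
      this ▸ hopen.preimage continuous_subtype_val
    ext z
    refine ⟨fun hz => ⟨1, ?_, ?_⟩, fun ⟨x, hxU, hxz⟩ => ?_⟩
    · exact (Set.ext_iff.1 hU_inter 0).2 rfl
    · rw [map_one, Set.mem_singleton_iff.1 hz, Subgroup.coe_one]
    · have hx : x.toAdd ∈ liftedKer ρ := mem_liftedKer.2 (hxz ▸ z.2)
      have hx₀ : x.toAdd = 0 := congrArg Subtype.val ((Set.ext_iff.1 hU_inter ⟨_, hx⟩).1 hxU)
      refine Subtype.ext (hxz.symm.trans ?_)
      rw [toAdd_eq_zero.1 hx₀, map_one, Subgroup.coe_one]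
  exact finite_of_compact_of_discrete

theorem discreteTopology_of_mem_iff {E : Type*} [NormedAddCommGroup E] [NormedSpace ℝ E]
    [FiniteDimensional ℝ E] [Finite ι] {L : AddSubgroup E} {φ : E →ₗ[ℝ] (ι → ℝ)}
    (hφ : Function.Injective φ)
    (hL : ∀ x, x ∈ L ↔ φ x ∈ Submodule.span ℤ (Set.range (Pi.basisFun ℝ ι))) :
    DiscreteTopology L := by
  have := Fintype.ofFinite ι
  obtain rfl : L = (ZLattice.comap ℝ (.span ℤ (Set.range (Pi.basisFun ℝ ι))) φ).toAddSubgroup :=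
    AddSubgroup.ext hL
  exact ZLattice.comap_discreteTopology ℝ _ φ.continuous_of_finiteDimensional hφ

theorem exists_injective_torus_hom_range_eq [TopologicalSpace H] [T1Space H] [Finite ι]
    (hρ : Continuous ρ) :
    ∃ (n : ℕ) (σ : (Fin n → Circle) →* H), n ≤ Nat.card ι ∧ Continuous σ ∧
      Function.Injective σ ∧ σ.range = ρ.range ∧ (n = Nat.card ι → Finite ρ.ker) := by
  have := Fintype.ofFinite ι
  have hexp := isOpenQuotientMap_torusExp ι
  obtain ⟨n, φ, hφ, hφ_mem⟩ :=
    exists_surjective_linearMap_mem_iff_of_isClosed (isClosed_liftedKer hρ) (span_liftedKer ρ)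
  let p : Multiplicative (ι → ℝ) →* (Fin n → Circle) :=
    (torusExp (Fin n)).comp φ.toAddMonoidHom.toMultiplicative
  have hp : IsOpenQuotientMap p := (isOpenQuotientMap_torusExp (Fin n)).comp
    ⟨hφ, φ.continuous_of_finiteDimensional, φ.isOpenMap_of_finiteDimensional hφ⟩
  have hker : p.ker = (ρ.comp (torusExp ι)).ker :=
    Subgroup.ext fun x => torusExp_eq_one_iff.trans (hφ_mem x.toAdd).symm
  obtain ⟨σ, hσ, hσ_inj, hσ_comp⟩ :=
    exists_continuous_injective_hom_of_ker_eq hp (hρ.comp hexp.continuous) hker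
  have hrange : σ.range = ρ.range := by
    calc σ.range = (σ.comp p).range := by rw [MonoidHom.range_comp,
          MonoidHom.range_eq_top.2 hp.surjective, ← MonoidHom.range_eq_map]
      _ = (ρ.comp (torusExp ι)).range := by rw [hσ_comp]
      _ = ρ.range := by rw [MonoidHom.range_comp,
          MonoidHom.range_eq_top.2 hexp.surjective, ← MonoidHom.range_eq_map]
  have hfinrank : Module.finrank ℝ (ι → ℝ) = Nat.card ι := by simp
  have hn : n ≤ Nat.card ι := by
    simpa [hfinrank] using LinearMap.finrank_le_finrank_of_surjective hφ
  refine ⟨n, σ, hn, hσ, hσ_inj, hrange, fun hn_eq => ?_⟩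
  have hφ_inj : Function.Injective φ :=
    (LinearMap.injective_iff_surjective_of_finrank_eq_finrank (by simp [hfinrank, hn_eq])).2 hφ
  have := discreteTopology_of_mem_iff hφ_inj hφ_mem
  exact finite_ker_of_discreteTopology_liftedKer hρ

end Torus

section Splitting

theorem exists_circle_zpow_eq {k : ℤ} (hk : k ≠ 0) (z : Circle) : ∃ w : Circle, w ^ k = z := by
  obtain ⟨x, rfl⟩ := Circle.exp_surjective z
  refine ⟨Circle.exp (x / k), ?_⟩
  rw [← Circle.exp_intCast_mul, mul_div_cancel₀ x (Int.cast_ne_zero.2 hk)]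

noncomputable instance circleRootableBy : RootableBy Circle ℤ :=
  rootableByOfPowLeftSurj _ _ fun hk => exists_circle_zpow_eq hk

theorem exists_leftInverse_hom_of_injective {G D : Type*} [CommGroup G] [CommGroup D]
    [RootableBy D ℤ] {σ : D →* G} (hσ : Function.Injective σ) :
    ∃ τ : G →* D, Function.LeftInverse τ σ := by
  let _ : DivisibleBy (Additive D) ℤ := divisibleByOfSMulRightSurj _ _ fun {k} hk x =>
    ⟨.ofMul (RootableBy.root x.toMul k),
      congrArg Additive.ofMul (RootableBy.root_cancel x.toMul hk)⟩
  obtain ⟨τ, hτ⟩ := (Module.Baer.of_divisible (Additive D)).extension_property_addMonoidHom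
    (MonoidHom.toAdditive σ) hσ (AddMonoidHom.id _)
  exact ⟨MonoidHom.toAdditive.symm τ, fun a => DFunLike.congr_fun hτ (Additive.ofMul a)⟩

theorem continuous_of_leftInverse_of_isOpenEmbedding {G A : Type*} [Group G] [TopologicalSpace G]
    [IsTopologicalGroup G] [Group A] [TopologicalSpace A] [IsTopologicalGroup A] {σ : A →* G}
    {τ : G →* A} (hτ : Function.LeftInverse τ σ) (hσ : IsOpenEmbedding σ) : Continuous τ := by
  refine continuous_of_continuousAt_one τ ?_
  rw [← map_one σ, ← hσ.continuousAt_iff, hτ.comp_eq_id]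
  exact continuousAt_id

theorem isComplement'_ker_range_of_leftInverse {G A : Type*} [Group G] [Group A] {σ : A →* G}
    {τ : G →* A} (hτ : Function.LeftInverse τ σ) : Subgroup.IsComplement' τ.ker σ.range := by
  refine Subgroup.isComplement'_of_disjoint_and_mul_eq_univ ?_ (Set.eq_univ_of_forall fun g => ?_)
  · rw [Subgroup.disjoint_def]
    rintro _ hker ⟨a, rfl⟩
    rw [MonoidHom.mem_ker, hτ] at hker
    rw [hker, map_one]
  · refine ⟨g / σ (τ g), ?_, σ (τ g), ⟨τ g, rfl⟩, div_mul_cancel g _⟩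
    rw [SetLike.mem_coe, MonoidHom.mem_ker, map_div, hτ, div_self']

/-- The splitting of a topological abelian group `G` as the product of the kernel of a continuous
homomorphism `τ` and the image of a continuous section `σ` of `τ`. -/
def kerProdContinuousMulEquiv {G A : Type*} [CommGroup G] [TopologicalSpace G]
    [IsTopologicalGroup G] [Group A] [TopologicalSpace A] {σ : A →* G} {τ : G →* A}
    (hτσ : Function.LeftInverse τ σ) (hσ : Continuous σ) (hτ : Continuous τ) :
    G ≃ₜ* τ.ker × A where
  toFun g := (⟨g / σ (τ g), by rw [MonoidHom.mem_ker, map_div, hτσ, div_self']⟩, τ g)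
  invFun x := x.1 * σ x.2
  left_inv g := div_mul_cancel g _
  right_inv := by
    rintro ⟨⟨k, hk⟩, a⟩
    have hka : τ (k * σ a) = a := by rw [map_mul, MonoidHom.mem_ker.1 hk, hτσ, one_mul]
    simp only [hka, mul_div_cancel_right]
  map_mul' g h := by
    simp only [map_mul, mul_div_mul_comm]
    rfl
  continuous_toFun :=
    ((continuous_id.div' (hσ.comp hτ)).subtype_mk _).prodMk hτ
  continuous_invFun := by fun_prop

theorem exists_continuousMulEquiv_subgroup_prod {G A : Type*} [CommGroup G] [TopologicalSpace G]
    [IsTopologicalGroup G] [T2Space G] [CommGroup A] [RootableBy A ℤ] [TopologicalSpace A]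
    [IsTopologicalGroup A] [CompactSpace A] {σ : A →* G} (hσ : Continuous σ)
    (hσ_inj : Function.Injective σ) [σ.range.FiniteIndex] :
    ∃ K : Subgroup G, Nat.card K = σ.range.index ∧ Nonempty (G ≃ₜ* K × A) := by
  obtain ⟨τ, hτσ⟩ := exists_leftInverse_hom_of_injective hσ_inj
  have hopen : IsOpen (σ.range : Set G) :=
    σ.range.isOpen_of_isClosed_of_finiteIndex (isCompact_range hσ).isClosed
  have hτ : Continuous τ := continuous_of_leftInverse_of_isOpenEmbedding hτσ
    ⟨(hσ.isClosedEmbedding hσ_inj).isEmbedding, hopen⟩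
  exact ⟨τ.ker, (isComplement'_ker_range_of_leftInverse hτσ).index_eq_card.symm,
    ⟨kerProdContinuousMulEquiv hτσ hσ hτ⟩⟩

end Splitting

section FiniteExtension

variable {F A H : Type*} [Group F] [Group A] [Group H] {r : F × A →* H}

theorem index_range_comp_inr_dvd_card (hr : Function.Surjective r) :
    (r.comp (MonoidHom.inr F A)).range.index ∣ Nat.card F := by
  have hle : (MonoidHom.fst F A).ker ≤ (r.comp (MonoidHom.inr F A)).range.comap r := by
    rintro ⟨f, a⟩ (rfl : f = 1)
    exact ⟨a, rfl⟩
  have hcard : (MonoidHom.fst F A).ker.index = Nat.card F := by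
    rw [Subgroup.index_ker, MonoidHom.range_eq_top.2 Prod.fst_surjective, Subgroup.card_top]
  rw [← Subgroup.index_comap_of_surjective _ hr, ← hcard]
  exact Subgroup.index_dvd_of_le hle

theorem finite_ker_of_finite_ker_comp_inr [Finite F]
    (hr : Finite (r.comp (MonoidHom.inr F A)).ker) : Finite r.ker := by
  let fst : r.ker →* F := (MonoidHom.fst F A).comp r.ker.subtype
  have hfst : Finite fst.ker := by
    refine .of_injective (fun x => (⟨x.1.1.2, ?_⟩ : (r.comp (MonoidHom.inr F A)).ker)) ?_
    · obtain ⟨⟨⟨f, a⟩, hx⟩, rfl : f = 1⟩ := x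
      exact hx
    · rintro ⟨⟨⟨f, a⟩, _⟩, rfl : f = 1⟩ ⟨⟨⟨g, b⟩, _⟩, rfl : g = 1⟩ hab
      obtain rfl : a = b := congrArg Subtype.val hab
      rfl
  exact fst.finite_iff_finite_ker_range.2 ⟨hfst, inferInstance⟩

end FiniteExtension

section Torsion

theorem card_pow_eq_one_prod (M N : Type*) [Monoid M] [Monoid N] (p : ℕ) :
    Nat.card {x : M × N // x ^ p = 1} =
      Nat.card {x : M // x ^ p = 1} * Nat.card {x : N // x ^ p = 1} := by
  rw [← Nat.card_prod, ← Nat.card_congr (Equiv.subtypeProdEquivProd)]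
  exact Nat.card_congr (Equiv.subtypeEquivRight fun _ => Prod.ext_iff)

theorem card_pow_eq_one_pi (ι M : Type*) [Finite ι] [Monoid M] (p : ℕ) :
    Nat.card {x : ι → M // x ^ p = 1} = Nat.card {x : M // x ^ p = 1} ^ Nat.card ι := by
  rw [← Nat.card_fun, ← Nat.card_congr Equiv.subtypePiEquivPi]
  exact Nat.card_congr (Equiv.subtypeEquivRight fun _ => funext_iff)

theorem card_pow_eq_one_of_coprime {G : Type*} [Group G] {p : ℕ} (hp : (Nat.card G).Coprime p) :
    Nat.card {x : G // x ^ p = 1} = 1 := by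
  refine Nat.card_eq_one_iff_exists.2 ⟨⟨1, one_pow p⟩, fun x => Subtype.ext ?_⟩
  exact (powCoprime hp).injective (x.2.trans (one_pow p).symm)

theorem card_circle_pow_eq_one (p : ℕ) [NeZero p] : Nat.card {z : Circle // z ^ p = 1} = p := by
  refine Eq.trans (Nat.card_congr (toUnits.toEquiv.subtypeEquiv fun z => ?_))
    (HasEnoughRootsOfUnity.natCard_rootsOfUnity Circle p)
  exact (map_eq_one_iff toUnits toUnits.injective).symm.trans (by rw [map_pow]; rfl)

theorem card_prod_torus_pow_eq_one {F ι : Type*} [Group F] [Finite ι] {p : ℕ} [NeZero p]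
    (hp : (Nat.card F).Coprime p) :
    Nat.card {x : F × (ι → Circle) // x ^ p = 1} = p ^ Nat.card ι := by
  rw [card_pow_eq_one_prod, card_pow_eq_one_of_coprime hp, one_mul, card_pow_eq_one_pi,
    card_circle_pow_eq_one]

theorem card_pow_eq_one_of_surjective {G H : Type*} [CommGroup G] [Group H] {f : G →* H}
    (hf : Function.Surjective f) {p : ℕ} (hp : (Nat.card f.ker).Coprime p) :
    Nat.card {x : G // x ^ p = 1} = Nat.card {y : H // y ^ p = 1} := by
  refine Nat.card_congr (Equiv.ofBijective
    (fun x => ⟨f x, by rw [← map_pow, x.2, map_one]⟩) ⟨?_, ?_⟩)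
  · rintro ⟨x, hx⟩ ⟨y, hy⟩ hxy
    have hxy_ker : x / y ∈ f.ker := by
      rw [MonoidHom.mem_ker, map_div, div_eq_one]
      exact congrArg Subtype.val hxy
    have hxy_one : (⟨x / y, hxy_ker⟩ : f.ker) = 1 :=
      (powCoprime hp).injective (Subtype.ext (by simp [div_pow, hx, hy]))
    exact Subtype.ext (div_eq_one.1 (congrArg Subtype.val hxy_one))
  · rintro ⟨y, hy⟩
    obtain ⟨x, rfl⟩ := hf y
    rw [← map_pow] at hy
    obtain ⟨⟨k, hk⟩, hkx⟩ := (powCoprime hp).surjective ⟨x ^ p, hy⟩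
    have hkx' : k ^ p = x ^ p := congrArg Subtype.val hkx
    refine ⟨⟨x / k, by rw [div_pow, hkx', div_self']⟩, Subtype.ext ?_⟩
    simp only [map_div, MonoidHom.mem_ker.1 hk, div_one]

theorem card_eq_of_surjective_of_finite_ker {F F' ι κ : Type*} [CommGroup F] [Finite F]
    [Group F'] [Finite F'] [Finite ι] [Finite κ] {f : F × (ι → Circle) →* F' × (κ → Circle)}
    (hf : Function.Surjective f) (hker : Finite f.ker) : Nat.card κ = Nat.card ι := by
  obtain ⟨p, hp, hprime⟩ :=
    Nat.exists_infinite_primes (Nat.card F + Nat.card F' + Nat.card f.ker + 1)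
  have hcoprime : ∀ k, 0 < k → k < p → k.Coprime p := fun k hk hkp =>
    (Nat.coprime_of_lt_prime hk.ne' hkp hprime).symm
  have : NeZero p := ⟨hprime.ne_zero⟩
  refine Nat.pow_right_injective hprime.two_le ?_
  calc p ^ Nat.card κ = Nat.card {x : F' × (κ → Circle) // x ^ p = 1} :=
        (card_prod_torus_pow_eq_one (hcoprime _ Nat.card_pos (by lia))).symm
    _ = Nat.card {x : F × (ι → Circle) // x ^ p = 1} :=
        (card_pow_eq_one_of_surjective hf (hcoprime _ Nat.card_pos (by lia))).symm
    _ = p ^ Nat.card ι := card_prod_torus_pow_eq_one (hcoprime _ Nat.card_pos (by lia))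

theorem card_eq_of_mulEquiv {F F' ι κ : Type*} [CommGroup F] [Finite F] [Group F'] [Finite F']
    [Finite ι] [Finite κ] (e : F × (ι → Circle) ≃* F' × (κ → Circle)) :
    Nat.card κ = Nat.card ι := by
  refine card_eq_of_surjective_of_finite_ker (f := e.toMonoidHom) e.surjective ?_
  rw [(MonoidHom.ker_eq_bot_iff _).2 e.injective]
  infer_instance

end Torsion

theorem exists_continuousMulEquiv_subgroup_prod_torus {F ι H : Type*} [Group F] [Finite F]
    [TopologicalSpace F] [Finite ι] [CommGroup H] [TopologicalSpace H] [IsTopologicalGroup H]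
    [T2Space H] {r : F × (ι → Circle) →* H} (hr : Continuous r) (hr_surj : Function.Surjective r) :
    ∃ (K : Subgroup H) (n : ℕ), Nat.card K ∣ Nat.card F ∧ n ≤ Nat.card ι ∧
      Nonempty (H ≃ₜ* K × (Fin n → Circle)) ∧ (n = Nat.card ι → Finite r.ker) := by
  have hinr : Continuous (r.comp (MonoidHom.inr F _)) := hr.comp (.prodMk_right 1)
  obtain ⟨n, σ, hn, hσ, hσ_inj, hrange, hfin⟩ := exists_injective_torus_hom_range_eq hinr
  have hdvd : σ.range.index ∣ Nat.card F := hrange ▸ index_range_comp_inr_dvd_card hr_surj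
  have : σ.range.FiniteIndex := ⟨ne_zero_of_dvd_ne_zero Nat.card_pos.ne' hdvd⟩
  obtain ⟨K, hK, e⟩ := exists_continuousMulEquiv_subgroup_prod hσ hσ_inj
  exact ⟨K, n, hK ▸ hdvd, hn, e, fun hn_eq => finite_ker_of_finite_ker_comp_inr (hfin hn_eq)⟩

/-- Replaces the first factor of a product of topological groups by its copy in `Type`, which is
where the finite factor of `H` has to live. -/
noncomputable def shrinkProdContinuousMulEquiv (K A : Type*) [Small.{0} K] [Group K]
    [TopologicalSpace K] [Group A] [TopologicalSpace A] : K × A ≃ₜ* Shrink.{0} K × A where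
  __ := (Shrink.mulEquiv.{0} (α := K)).symm.prodCongr (.refl A)
  continuous_toFun := (Shrink.homeomorph.{0} K).continuous.prodMap continuous_id
  continuous_invFun := (Shrink.homeomorph.{0} K).symm.continuous.prodMap continuous_id

theorem mainTheorem12_general {F ι H : Type*} [CommGroup F] [Finite F] [TopologicalSpace F]
    [Finite ι] [Group H] [TopologicalSpace H] [IsTopologicalGroup H] [T2Space H]
    (r : F × (ι → Circle) →* H) (hr : Continuous r) (hr_surj : Function.Surjective r) :
    (∃ (F' : Type) (_ : CommGroup F') (_ : Finite F') (_ : TopologicalSpace F')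
        (_ : DiscreteTopology F') (n : ℕ),
        Nonempty (H ≃ₜ* F' × (Fin n → Circle)) ∧ Nat.card F' ∣ Nat.card F ∧ n ≤ Nat.card ι) ∧
    (∀ (F' : Type*) [Group F'] [Finite F'] (n : ℕ),
        Nonempty (H ≃* F' × (Fin n → Circle)) → (n = Nat.card ι ↔ Finite r.ker)) := by
  let _ : CommGroup H := r.commGroupOfSurjective hr_surj
  obtain ⟨K, n₀, hK_dvd, hn₀, ⟨e₀⟩, hfin⟩ :=
    exists_continuousMulEquiv_subgroup_prod_torus hr hr_surj
  have : Finite K := Nat.finite_of_card_ne_zero (ne_zero_of_dvd_ne_zero Nat.card_pos.ne' hK_dvd)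
  refine ⟨?_, fun F' _ _ n ⟨e⟩ => ?_⟩
  · exact ⟨Shrink.{0} K, inferInstance, inferInstance, inferInstance,
      (Shrink.homeomorph.{0} K).discreteTopology, n₀, ⟨e₀.trans (shrinkProdContinuousMulEquiv K _)⟩,
      Nat.card_congr (equivShrink.{0} K) ▸ hK_dvd, hn₀⟩
  · have hn : n = n₀ := by
      simpa using card_eq_of_mulEquiv (e₀.toMulEquiv.symm.trans e)
    have hn_of_ker : Finite r.ker → n = Nat.card ι := fun hker => by
      have hker' : Finite (e.toMonoidHom.comp r).ker := by
        rwa [MonoidHom.ker_comp_of_injective r e.toMonoidHom e.injective]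
      simpa using card_eq_of_surjective_of_finite_ker (e.surjective.comp hr_surj) hker'
    exact ⟨fun h => hfin (hn ▸ h), hn_of_ker⟩

theorem mainTheorem12 {F H : Type*} (m : ℕ)
    [CommGroup F] [Finite F] [TopologicalSpace F] [DiscreteTopology F]
    [Group H] [TopologicalSpace H] [IsTopologicalGroup H] [CompactSpace H] [T2Space H]
    (r : F × (Fin m → Circle) →* H) (hr_cont : Continuous r)
    (hr_surj : Function.Surjective r) :
    (∃ (F' : Type) (_ : CommGroup F') (_ : Finite F') (_ : TopologicalSpace F')
        (_ : DiscreteTopology F') (n : ℕ),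
        Nonempty (H ≃ₜ* F' × (Fin n → Circle)) ∧ Nat.card F' ≤ Nat.card F ∧ n ≤ m) ∧
    (∀ (F' : Type) [CommGroup F'] [Finite F'] [TopologicalSpace F'] [DiscreteTopology F']
        (n : ℕ), Nonempty (H ≃ₜ* F' × (Fin n → Circle)) →
        (n = m ↔ Finite r.ker)) := by
  obtain ⟨⟨F', _, _, _, _, n, e, hdvd, hn⟩, h⟩ := mainTheorem12_general r hr_cont hr_surj
  rw [Nat.card_fin] at hn h
  exact ⟨⟨F', ‹_›, ‹_›, ‹_›, ‹_›, n, e, Nat.le_of_dvd Nat.card_pos hdvd, hn⟩,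
    fun F' _ _ _ _ n ⟨e⟩ => h F' n ⟨e.toMulEquiv⟩⟩
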